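/- **Definitions.** For a continuous function $U$ on $[a,b]$ and $x\in[a,b)$ put $\underline{LD}^{+}U(x)=\liminf_{s\to\infty}s^{2}\int_{0}^{\delta}e^{-st}\,[U(x+t)-U(x)]\,dt$, and for $x\in(a,b]$ put $\underline{LD}^{-}U(x)=\liminf_{s\to\infty}(-s^{2})\int_{0}^{\delta}e^{-st}\,[U(x-t)-U(x)]\,dt$ (the values do not depend on the choice of a small $\delta>0$); $\overline{LD}^{\pm}U(x)$ is defined with $\limsup$ instead. Let $f\colon[a,b]\to\mathbb{R}$. A *major function* of $f$ on $[a,b]$ is a continuous $U\colon[a,b]\to\mathbb{R}$ with $\underline{LD}^{+}U(x)\ge f(x)$ for all $x\in[a,b)$ and $\underline{LD}^{-}U(x)\ge f(x)$ for all $x\in(a,b]$; a *minor function* is a continuous $V$ with $\overline{LD}^{+}V(x)\le f(x)$ for all $x\in[a,b)$ and $\overline{LD}^{-}V(x)\le f(x)$ for all $x\in(a,b]$. $f$ is *Laplace integrable* on $[a,b]$, $f\in\mathcal{LP}[a,b]$, if $\inf_U\,(U(b)-U(a))=\sup_V\,(V(b)-V(a))\in\mathbb{R}$, where $U$ and $V$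 range over the major and minor functions of $f$; the common value is $\int_a^b f$. A function $f$ on $[a,\infty)$ belongs to $\mathcal{LP}[a,\infty]$ if $f\in\mathcal{LP}[a,c]$ for all $c\ge a$ and $\int_a^\infty f:=\lim_{c\to\infty}\int_a^c f$ exists in $\mathbb{R}$. $L^1$ and $\mathcal{BV}$ denote the Lebesgue integrable functions and the functions of bounded variation. All the integrals of $f$, $g$, $fG$ and $Fg$ below are Laplace integrals. **Theorem.** Let $a\in\mathbb{R}$, let $f,g\colon[a,\infty)\to\mathbb{R}$, and write $F(x)=\int_a^x f$, $G(x)=\int_a^x g$ for $x\ge a$. 1. (Du Bois-Reymond) Suppose that $f\in\mathcal{LP}[a,c]$ for all $c\ge a$, that $F$ is bounded on $[a,\infty)$, that $g\in L^1[a,\infty)\cap\mathcal{BV}[a,\infty)$, and that $\lim_{x\to\infty}F(x)G(x)$ exists in $\mathbb{R}$. Then $fG\in\mathcal{LP}[a,\infty]$. 2. (Integration by parts) Suppose that $f\in\mathcal{LP}[a,\infty]$ and $g\in L^1[a,\infty)\cap\mathcal{BV}[a,\infty)$. Then $fG\in\mathcal{LP}[a,\infty]$, $Fg\in\mathcal{LP}[a,\infty]$,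 the limit $\lim_{x\to\infty}F(x)G(x)$ exists in $\mathbb{R}$, and $$\int_a^\infty fG=\lim_{x\to\infty}F(x)G(x)-\int_a^\infty Fg .$$ -/

import Mathlib

open Filter Topology Set MeasureTheory

noncomputable section

/-- Lower right Laplace derivate of `U` at `x`, computed on `[x, x + δ]`:
`liminf_{s → ∞} s² ∫₀^δ e^{-st} (U (x + t) - U x) dt`. For `U` continuous on `[x, x + δ]` its value
does not depend on `δ > 0`. -/
def lowerRightLD (U : ℝ → ℝ) (x δ : ℝ) : EReal :=
  liminf (fun s : ℝ =>
    ((s ^ 2 * ∫ t in (0 : ℝ)..δ, Real.exp (-(s * t)) * (U (x + t) - U x) : ℝ) : EReal)) atTop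

/-- Upper right Laplace derivate of `U` at `x`, computed on `[x, x + δ]`. -/
def upperRightLD (U : ℝ → ℝ) (x δ : ℝ) : EReal :=
  limsup (fun s : ℝ =>
    ((s ^ 2 * ∫ t in (0 : ℝ)..δ, Real.exp (-(s * t)) * (U (x + t) - U x) : ℝ) : EReal)) atTop

/-- Lower left Laplace derivate of `U` at `x`, computed on `[x - δ, x]`:
`liminf_{s → ∞} (-s²) ∫₀^δ e^{-st} (U (x - t) - U x) dt`. -/
def lowerLeftLD (U : ℝ → ℝ) (x δ : ℝ) : EReal :=
  liminf (fun s : ℝ =>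
    ((-s ^ 2 * ∫ t in (0 : ℝ)..δ, Real.exp (-(s * t)) * (U (x - t) - U x) : ℝ) : EReal)) atTop

/-- Upper left Laplace derivate of `U` at `x`, computed on `[x - δ, x]`. -/
def upperLeftLD (U : ℝ → ℝ) (x δ : ℝ) : EReal :=
  limsup (fun s : ℝ =>
    ((-s ^ 2 * ∫ t in (0 : ℝ)..δ, Real.exp (-(s * t)) * (U (x - t) - U x) : ℝ) : EReal)) atTop

/-- `U` is a (Laplace) major function of `f` on `[a, b]`: it is continuous and its lower Laplace
derivate (one-sided at the end points) is at least `f x` at every point `x` of `[a, b]`. The usual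
requirement that the lower derivate be greater than `-∞` is implied, since `f` is real-valued. -/
structure IsLaplaceMajor (f : ℝ → ℝ) (a b : ℝ) (U : ℝ → ℝ) : Prop where
  continuousOn : ContinuousOn U (Icc a b)
  le_right : ∀ x ∈ Ico a b, (f x : EReal) ≤ lowerRightLD U x (b - x)
  le_left : ∀ x ∈ Ioc a b, (f x : EReal) ≤ lowerLeftLD U x (x - a)

/-- `V` is a (Laplace) minor function of `f` on `[a, b]`: it is continuous and its upper Laplace
derivate (one-sided at the end points) is at most `f x` at every point `x` of `[a, b]`. -/
structure IsLaplaceMinor (f : ℝ → ℝ) (a b : ℝ) (V : ℝ → ℝ) : Prop where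
  continuousOn : ContinuousOn V (Icc a b)
  right_le : ∀ x ∈ Ico a b, upperRightLD V x (b - x) ≤ (f x : EReal)
  left_le : ∀ x ∈ Ioc a b, upperLeftLD V x (x - a) ≤ (f x : EReal)

/-- The increments over `[a, b]` of the major functions of `f`. -/
def laplaceMajorIncrements (f : ℝ → ℝ) (a b : ℝ) : Set ℝ :=
  {r | ∃ U, IsLaplaceMajor f a b U ∧ r = U b - U a}

/-- The increments over `[a, b]` of the minor functions of `f`. -/
def laplaceMinorIncrements (f : ℝ → ℝ) (a b : ℝ) : Set ℝ :=
  {r | ∃ V, IsLaplaceMinor f a b V ∧ r = V b - V a}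

/-- `f` has Laplace integral `I` on `[a, b]` (where `a ≤ b`): the infimum of the increments of the
major functions and the supremum of the increments of the minor functions both equal the real
number `I`. In particular `f` has major and minor functions, as no real number is the infimum or
supremum of `∅`. -/
def HasLaplaceIntegral (f : ℝ → ℝ) (a b I : ℝ) : Prop :=
  IsGLB (laplaceMajorIncrements f a b) I ∧ IsLUB (laplaceMinorIncrements f a b) I

/-- `f` is Laplace integrable on the compact interval `[a, b]`, i.e. `f ∈ LP[a, b]`. -/
def LaplaceIntegrable (f : ℝ → ℝ) (a b : ℝ) : Prop :=
  ∃ I, HasLaplaceIntegral f a b I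

/-- The Laplace integral `∫_a^b f` (meaningful when `LaplaceIntegrable f a b`). -/
def laplaceIntegral (f : ℝ → ℝ) (a b : ℝ) : ℝ :=
  sInf (laplaceMajorIncrements f a b)

theorem HasLaplaceIntegral.laplaceIntegral_eq {f : ℝ → ℝ} {a b I : ℝ}
    (h : HasLaplaceIntegral f a b I) : laplaceIntegral f a b = I :=
  h.1.csInf_eq h.1.nonempty

/-- `f` is Laplace integrable on `[a, ∞]`, i.e. `f ∈ LP[a, ∞]`. -/
def LaplaceIntegrableIci (f : ℝ → ℝ) (a : ℝ) : Prop :=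
  (∀ c, a ≤ c → LaplaceIntegrable f a c) ∧
    ∃ L, Tendsto (fun c => laplaceIntegral f a c) atTop (𝓝 L)

/-- The Laplace integral `∫_a^∞ f` (meaningful when `LaplaceIntegrableIci f a`). -/
def laplaceIntegralIci (f : ℝ → ℝ) (a : ℝ) : ℝ :=
  limUnder atTop (fun c => laplaceIntegral f a c)

end

/-! The core is integration by parts on a compact interval: `f G` has Laplace integral `F(b) G(b) -
∫ F g`, where `F g` is Lebesgue integrable because `F` is continuous.

If `U` is a major function of `f` and `G ≥ 0` is a primitive of a bounded `g`, the right increment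
of `U G - ∫ U g` at `x` is `G(x) (U(x+t) - U(x))` plus the remainder `U(x+t) (G(x+t) - G(x)) - ∫ U
g` over `[x, x+t]`. The remainder is `o(t)` since `U` is continuous, so only `G(x) f(x)` survives
(`IsLaplaceMajor.mul_primitive`). A primitive of variable sign is written `(G + K) - K` with `K ≥
|G|`: a major function handles `f (G + K)`, a minor function handles `-K f`
(`exists_isLaplaceMajor_mul`). Minor functions of `f G` come from negating `f`.

Two facts support this. A continuous function with nonnegative lower Laplace derivates is
nondecreasing (`IsLaplaceMajor.le_of_zero`), so major increments dominate minor ones. Lebesgue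
integrable functions are Laplace integrable with the same value, by Vitali–Carathéodory.

On `[a, ∞)`, `F` is bounded and `g ∈ L¹`, so `F g ∈ L¹` and the compact formula passes to the limit.
When `f` is integrable up to `∞`, both `F` and `G` converge, and `F`, being continuous, is bounded.
-/

/-! ### Laplace means and their lower limits -/

/-- The Laplace mean `s² ∫₀^δ e^{-st} φ(t) dt`. -/
noncomputable def laplaceMean (φ : ℝ → ℝ) (δ s : ℝ) : ℝ :=
  s ^ 2 * ∫ t in (0 : ℝ)..δ, Real.exp (-(s * t)) * φ t

/-- The lower limit of the Laplace means of `φ` over `[0, δ]` is at least `m`. -/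
def LaplaceGE (φ : ℝ → ℝ) (δ m : ℝ) : Prop :=
  ∀ ε > 0, ∀ᶠ s in atTop, m - ε ≤ laplaceMean φ δ s

theorem intervalIntegrable_exp_mul {φ : ℝ → ℝ} {p q δ : ℝ} (hφ : ContinuousOn φ (Icc 0 δ))
    (hp : 0 ≤ p) (hpq : p ≤ q) (hq : q ≤ δ) (s : ℝ) :
    IntervalIntegrable (fun t => Real.exp (-(s * t)) * φ t) volume p q := by
  apply ContinuousOn.intervalIntegrable_of_Icc hpq
  exact (by fun_prop : Continuous fun t => Real.exp (-(s * t))).continuousOn.mul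
    (hφ.mono (Icc_subset_Icc hp hq))

theorem laplaceMean_add {φ ψ : ℝ → ℝ} {δ : ℝ} (hδ : 0 ≤ δ) (hφ : ContinuousOn φ (Icc 0 δ))
    (hψ : ContinuousOn ψ (Icc 0 δ)) (s : ℝ) :
    laplaceMean (fun t => φ t + ψ t) δ s = laplaceMean φ δ s + laplaceMean ψ δ s := by
  unfold laplaceMean
  rw [← mul_add, ← intervalIntegral.integral_add
    (intervalIntegrable_exp_mul hφ le_rfl hδ le_rfl s)
    (intervalIntegrable_exp_mul hψ le_rfl hδ le_rfl s)]
  simp only [mul_add]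

theorem laplaceMean_const_mul (φ : ℝ → ℝ) (k δ s : ℝ) :
    laplaceMean (fun t => k * φ t) δ s = k * laplaceMean φ δ s := by
  unfold laplaceMean
  simp only [mul_left_comm _ k, intervalIntegral.integral_const_mul]

theorem laplaceMean_mono {φ ψ : ℝ → ℝ} {δ : ℝ} (hδ : 0 ≤ δ) (hφ : ContinuousOn φ (Icc 0 δ))
    (hψ : ContinuousOn ψ (Icc 0 δ)) (h : ∀ t ∈ Icc 0 δ, φ t ≤ ψ t) (s : ℝ) :
    laplaceMean φ δ s ≤ laplaceMean ψ δ s := by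
  unfold laplaceMean
  refine mul_le_mul_of_nonneg_left ?_ (sq_nonneg s)
  exact intervalIntegral.integral_mono_on hδ (intervalIntegrable_exp_mul hφ le_rfl hδ le_rfl s)
    (intervalIntegrable_exp_mul hψ le_rfl hδ le_rfl s)
    fun t ht => mul_le_mul_of_nonneg_left (h t ht) (Real.exp_pos _).le

theorem tendsto_pow_mul_exp_neg_mul (n : ℕ) {η : ℝ} (hη : 0 < η) :
    Tendsto (fun s : ℝ => s ^ n * Real.exp (-(s * η))) atTop (𝓝 0) := by
  have h := ((Real.tendsto_pow_mul_exp_neg_atTop_nhds_zero n).comp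
    (tendsto_id.atTop_mul_const hη)).const_mul ((η ^ n)⁻¹)
  simp only [mul_zero] at h
  refine h.congr fun s => ?_
  simp only [Function.comp, id]
  field_simp
  ring

theorem laplaceMean_id {s : ℝ} (η : ℝ) :
    laplaceMean (fun t => t) η s = 1 - (1 + s * η) * Real.exp (-(s * η)) := by
  unfold laplaceMean
  rw [← intervalIntegral.integral_const_mul]
  have := intervalIntegral.integral_eq_sub_of_hasDerivAt (a := 0) (b := η)
    (f := fun t => -((1 + s * t) * Real.exp (-(s * t))))
    (f' := fun t => s ^ 2 * (Real.exp (-(s * t)) * t)) (fun t _ => by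
      have h1 : HasDerivAt (fun t : ℝ => s * t) s t := by
        simpa using (hasDerivAt_id t).const_mul s
      have h2 : HasDerivAt (fun t => Real.exp (-(s * t))) (Real.exp (-(s * t)) * -s) t :=
        h1.neg.exp
      have h3 : HasDerivAt (fun t => -((1 + s * t) * Real.exp (-(s * t))))
          (-(s * Real.exp (-(s * t)) + (1 + s * t) * (Real.exp (-(s * t)) * -s))) t :=
        ((h1.const_add 1).mul h2).neg
      exact h3.congr_deriv (by ring)) (Continuous.intervalIntegrable (by fun_prop) _ _)
  rw [this]
  simp
  ring

theorem tendsto_laplaceMean_id {η : ℝ} (hη : 0 < η) :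
    Tendsto (fun s => laplaceMean (fun t => t) η s) atTop (𝓝 1) := by
  have h := ((tendsto_pow_mul_exp_neg_mul 0 hη).add
    ((tendsto_pow_mul_exp_neg_mul 1 hη).const_mul η)).const_sub 1
  simp only [mul_zero, add_zero, sub_zero] at h
  refine h.congr fun s => ?_
  rw [laplaceMean_id]
  ring

/-- On `[η, δ]` the weight is at most `s² e^{-sη}`, which tends to `0`. This is why derivates do not
depend on the choice of `δ`. -/
theorem tendsto_laplaceMean_sub {φ : ℝ → ℝ} {η δ : ℝ} (hη : 0 < η) (hδ : η ≤ δ)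
    (hφ : ContinuousOn φ (Icc 0 δ)) :
    Tendsto (fun s => laplaceMean φ δ s - laplaceMean φ η s) atTop (𝓝 0) := by
  obtain ⟨C, hC⟩ := isCompact_Icc.exists_bound_of_continuousOn hφ
  have h := (tendsto_pow_mul_exp_neg_mul 2 hη).mul_const (C * |δ - η|)
  rw [zero_mul] at h
  refine squeeze_zero_norm' ?_ h
  filter_upwards [eventually_ge_atTop 0] with s hs
  unfold laplaceMean
  rw [← mul_sub, intervalIntegral.integral_interval_sub_left
    (intervalIntegrable_exp_mul hφ le_rfl (hη.le.trans hδ) le_rfl s)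
    (intervalIntegrable_exp_mul hφ le_rfl hη.le hδ s), norm_mul, norm_pow,
    Real.norm_of_nonneg hs, mul_assoc]
  refine mul_le_mul_of_nonneg_left ?_ (by positivity)
  rw [← mul_assoc]
  refine intervalIntegral.norm_integral_le_of_norm_le_const fun t ht => ?_
  rw [uIoc_of_le hδ] at ht
  rw [norm_mul, Real.norm_of_nonneg (Real.exp_pos _).le]
  refine mul_le_mul (Real.exp_le_exp.2 ?_) (hC t ⟨hη.le.trans ht.1.le, ht.2⟩) (norm_nonneg _)
    (Real.exp_pos _).le
  exact neg_le_neg (mul_le_mul_of_nonneg_left ht.1.le hs)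

theorem laplaceGE_iff_of_le {φ : ℝ → ℝ} {η δ m : ℝ} (hη : 0 < η) (hδ : η ≤ δ)
    (hφ : ContinuousOn φ (Icc 0 δ)) : LaplaceGE φ δ m ↔ LaplaceGE φ η m := by
  have h := tendsto_laplaceMean_sub hη hδ hφ
  constructor <;> intro H ε hε
  · filter_upwards [H (ε / 2) (half_pos hε), h.eventually_lt_const (half_pos hε)] with s h1 h2
    linarith
  · filter_upwards [H (ε / 2) (half_pos hε),
      h.eventually_const_lt (neg_lt_zero.2 (half_pos hε))] with s h1 h2
    linarith

theorem LaplaceGE.congr {φ ψ : ℝ → ℝ} {δ m : ℝ} (hδ : 0 ≤ δ) (h : LaplaceGE φ δ m)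
    (hφψ : EqOn φ ψ (Icc 0 δ)) : LaplaceGE ψ δ m := by
  intro ε hε
  filter_upwards [h ε hε] with s hs
  refine hs.trans_eq ?_
  unfold laplaceMean
  congr 1
  refine intervalIntegral.integral_congr fun t ht => ?_
  rw [uIcc_of_le hδ] at ht
  simp only [hφψ ht]

theorem LaplaceGE.add {φ ψ : ℝ → ℝ} {δ m n : ℝ} (hδ : 0 ≤ δ) (hφ : ContinuousOn φ (Icc 0 δ))
    (hψ : ContinuousOn ψ (Icc 0 δ)) (h : LaplaceGE φ δ m) (h' : LaplaceGE ψ δ n) :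
    LaplaceGE (fun t => φ t + ψ t) δ (m + n) := by
  intro ε hε
  filter_upwards [h (ε / 2) (half_pos hε), h' (ε / 2) (half_pos hε)] with s h1 h2
  rw [laplaceMean_add hδ hφ hψ]
  linarith

theorem LaplaceGE.const_mul {φ : ℝ → ℝ} {δ m k : ℝ} (hk : 0 ≤ k) (h : LaplaceGE φ δ m) :
    LaplaceGE (fun t => k * φ t) δ (k * m) := by
  intro ε hε
  have hk1 : 0 < k + 1 := by linarith
  -- Dividing by `k + 1` instead of `k` covers `k = 0`.
  filter_upwards [h (ε / (k + 1)) (div_pos hε hk1)] with s hs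
  rw [laplaceMean_const_mul]
  have h1 := mul_le_mul_of_nonneg_left hs hk
  have h2 : k * (ε / (k + 1)) ≤ ε := by
    rw [mul_div_assoc', div_le_iff₀ hk1]
    nlinarith
  linarith

/-- A lower bound `m` for the lower Dini derivate of `φ` at `0` bounds the Laplace derivate. -/
theorem LaplaceGE.of_eventually {φ : ℝ → ℝ} {δ m : ℝ} (hδ : 0 < δ)
    (hφ : ContinuousOn φ (Icc 0 δ))
    (h : ∀ ε > 0, ∃ η > 0, ∀ t ∈ Icc 0 η, t ≤ δ → (m - ε) * t ≤ φ t) : LaplaceGE φ δ m := by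
  intro ε hε
  obtain ⟨η, hη, H⟩ := h (ε / 2) (half_pos hε)
  have hη' : 0 < min η δ := lt_min hη hδ
  have h1 : LaplaceGE φ (min η δ) (m - ε / 2) := by
    intro e he
    filter_upwards [((tendsto_laplaceMean_id hη').const_mul (m - ε / 2)).eventually_const_lt
      (show (m - ε / 2) - e < (m - ε / 2) * 1 by linarith)] with s hs
    rw [← laplaceMean_const_mul] at hs
    refine hs.le.trans (laplaceMean_mono hη'.le (by fun_prop)
      (hφ.mono (Icc_subset_Icc le_rfl (min_le_right _ _))) (fun t ht => ?_) s)
    exact H t ⟨ht.1, ht.2.trans (min_le_left _ _)⟩ (ht.2.trans (min_le_right _ _))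
  have h2 := (laplaceGE_iff_of_le hη' (min_le_right _ _) hφ).2 h1
  filter_upwards [h2 (ε / 2) (half_pos hε)] with s hs
  linarith

/-- If `φ ≤ 0` throughout, every Laplace mean is nonpositive and cannot eventually exceed `m / 2`.
-/
theorem LaplaceGE.exists_pos {φ : ℝ → ℝ} {δ m : ℝ} (hδ : 0 ≤ δ)
    (hφ : ContinuousOn φ (Icc 0 δ)) (h0 : φ 0 = 0) (hm : 0 < m) (h : LaplaceGE φ δ m) :
    ∃ t ∈ Ioc 0 δ, 0 < φ t := by
  by_contra! H
  obtain ⟨s, hs⟩ := (h (m / 2) (half_pos hm)).exists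
  have h1 := laplaceMean_mono (ψ := fun _ => 0) hδ hφ continuousOn_const (fun t ht => by
    rcases ht.1.eq_or_lt with h | h
    · rw [← h, h0]
    · exact H t ⟨h, ht.2⟩) s
  simp only [laplaceMean, mul_zero, intervalIntegral.integral_zero] at h1 hs
  linarith

/-! ### Algebra of major and minor functions -/

/-- Replaces extended-real lower limits by real inequalities. Absorbing the sign into the increment
`U x - U (x - t)` lets left and right derivates share the same lemmas. -/
theorem isLaplaceMajor_iff {f U : ℝ → ℝ} {a b : ℝ} :
    IsLaplaceMajor f a b U ↔ ContinuousOn U (Icc a b) ∧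
      (∀ x ∈ Ico a b, LaplaceGE (fun t => U (x + t) - U x) (b - x) (f x)) ∧
      ∀ x ∈ Ioc a b, LaplaceGE (fun t => U x - U (x - t)) (x - a) (f x) := by
  have key : ∀ (m : ℝ) (q : ℝ → ℝ), (m : EReal) ≤ liminf (fun s => (q s : EReal)) atTop ↔
      ∀ ε > 0, ∀ᶠ s in atTop, m - ε ≤ q s := by
    intro m q
    rw [le_liminf_iff]
    constructor
    · intro h ε hε
      filter_upwards [h ((m - ε : ℝ) : EReal) (by exact_mod_cast sub_lt_self m hε)] with s hs
      exact_mod_cast hs.le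
    · intro h y hy
      -- The bound `y` may be `⊥`, so a real number is interposed before choosing `ε = m - z`.
      obtain ⟨z, hyz, hzm⟩ := EReal.exists_between_coe_real hy
      have hzm' : z < m := by exact_mod_cast hzm
      filter_upwards [h (m - z) (by linarith)] with s hs
      refine hyz.trans_le ?_
      have : z ≤ q s := by linarith
      exact_mod_cast this
  have hl : ∀ x s : ℝ, -s ^ 2 * ∫ t in (0 : ℝ)..(x - a), Real.exp (-(s * t)) * (U (x - t) - U x)
      = laplaceMean (fun t => U x - U (x - t)) (x - a) s := by
    intro x s
    unfold laplaceMean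
    rw [neg_mul, ← mul_neg, ← intervalIntegral.integral_neg]
    simp only [← mul_neg, neg_sub]
  constructor
  · rintro ⟨h1, h2, h3⟩
    refine ⟨h1, fun x hx => (key _ _).1 (h2 x hx), fun x hx => ?_⟩
    have := (key _ _).1 (h3 x hx)
    simp only [hl] at this
    exact this
  · rintro ⟨h1, h2, h3⟩
    refine ⟨h1, fun x hx => (key _ _).2 (h2 x hx), fun x hx => (key _ _).2 ?_⟩
    simp only [hl]
    exact h3 x hx

/-- Reduces statements on minor functions to statements on major functions. -/
theorem isLaplaceMinor_iff_neg {f V : ℝ → ℝ} {a b : ℝ} :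
    IsLaplaceMinor f a b V ↔ IsLaplaceMajor (fun x => -f x) a b (fun x => -V x) := by
  have key : ∀ (m : ℝ) (q : ℝ → ℝ), limsup (fun s => (q s : EReal)) atTop ≤ m ↔
      ((-m : ℝ) : EReal) ≤ liminf (fun s => ((-q s : ℝ) : EReal)) atTop := by
    intro m q
    simp only [EReal.coe_neg]
    rw [show (fun s => -(q s : EReal)) = -(fun s => (q s : EReal)) from rfl,
      EReal.liminf_neg, EReal.neg_le_neg_iff]
  have hr : ∀ x d s : ℝ, s ^ 2 * ∫ t in (0 : ℝ)..d, Real.exp (-(s * t)) * (-V (x + t) - -V x) =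
      -(s ^ 2 * ∫ t in (0 : ℝ)..d, Real.exp (-(s * t)) * (V (x + t) - V x)) := by
    intro x d s
    rw [← mul_neg, ← intervalIntegral.integral_neg]
    simp only [← mul_neg, neg_sub, neg_sub_neg]
  have hl : ∀ x d s : ℝ, -s ^ 2 * ∫ t in (0 : ℝ)..d, Real.exp (-(s * t)) * (-V (x - t) - -V x) =
      -(-s ^ 2 * ∫ t in (0 : ℝ)..d, Real.exp (-(s * t)) * (V (x - t) - V x)) := by
    intro x d s
    rw [← mul_neg, ← intervalIntegral.integral_neg]
    simp only [← mul_neg, neg_sub, neg_sub_neg]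
  constructor
  · rintro ⟨h1, h2, h3⟩
    refine ⟨h1.neg, fun x hx => ?_, fun x hx => ?_⟩
    · simp only [lowerRightLD, hr]
      exact (key _ _).1 (h2 x hx)
    · simp only [lowerLeftLD, hl]
      exact (key _ _).1 (h3 x hx)
  · rintro ⟨h1, h2, h3⟩
    simp only [lowerRightLD, hr] at h2
    simp only [lowerLeftLD, hl] at h3
    refine ⟨by simpa only [neg_neg] using h1.fun_neg, fun x hx => (key _ _).2 (h2 x hx),
      fun x hx => (key _ _).2 (h3 x hx)⟩

theorem ContinuousOn.right_increment {U : ℝ → ℝ} {a b x : ℝ} (hU : ContinuousOn U (Icc a b))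
    (hx : a ≤ x) : ContinuousOn (fun t => U (x + t) - U x) (Icc 0 (b - x)) :=
  (hU.comp (by fun_prop) fun t ht => ⟨by linarith [ht.1], by linarith [ht.2]⟩).sub
    continuousOn_const

theorem ContinuousOn.left_increment {U : ℝ → ℝ} {a b x : ℝ} (hU : ContinuousOn U (Icc a b))
    (hx : x ≤ b) : ContinuousOn (fun t => U x - U (x - t)) (Icc 0 (x - a)) :=
  continuousOn_const.sub
    (hU.comp (by fun_prop) fun t ht => ⟨by linarith [ht.2], by linarith [ht.1]⟩)

theorem IsLaplaceMajor.congr {f U W : ℝ → ℝ} {a b : ℝ} (h : IsLaplaceMajor f a b U)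
    (hUW : EqOn U W (Icc a b)) : IsLaplaceMajor f a b W := by
  rw [isLaplaceMajor_iff] at h ⊢
  obtain ⟨h1, h2, h3⟩ := h
  refine ⟨h1.congr hUW.symm, fun x hx => (h2 x hx).congr (sub_nonneg.2 hx.2.le) fun t ht => ?_,
    fun x hx => (h3 x hx).congr (sub_nonneg.2 hx.1.le) fun t ht => ?_⟩
  · rw [hUW ⟨by linarith [ht.1, hx.1], by linarith [ht.2]⟩, hUW ⟨hx.1, hx.2.le⟩]
  · rw [hUW ⟨hx.1.le, hx.2⟩, hUW ⟨by linarith [ht.2], by linarith [ht.1, hx.2]⟩]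

theorem IsLaplaceMajor.add {f h U W : ℝ → ℝ} {a b : ℝ} (hU : IsLaplaceMajor f a b U)
    (hW : IsLaplaceMajor h a b W) :
    IsLaplaceMajor (fun x => f x + h x) a b (fun x => U x + W x) := by
  rw [isLaplaceMajor_iff] at hU hW ⊢
  obtain ⟨h1, h2, h3⟩ := hU
  obtain ⟨k1, k2, k3⟩ := hW
  refine ⟨h1.add k1, fun x hx => ?_, fun x hx => ?_⟩
  · have := (h2 x hx).add (sub_nonneg.2 hx.2.le) (h1.right_increment hx.1)
      (k1.right_increment hx.1) (k2 x hx)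
    exact this.congr (sub_nonneg.2 hx.2.le) fun t _ => by ring
  · have := (h3 x hx).add (sub_nonneg.2 hx.1.le) (h1.left_increment hx.2)
      (k1.left_increment hx.2) (k3 x hx)
    exact this.congr (sub_nonneg.2 hx.1.le) fun t _ => by ring

theorem IsLaplaceMajor.const_mul {f U : ℝ → ℝ} {a b k : ℝ} (hk : 0 ≤ k)
    (hU : IsLaplaceMajor f a b U) :
    IsLaplaceMajor (fun x => k * f x) a b (fun x => k * U x) := by
  rw [isLaplaceMajor_iff] at hU ⊢
  obtain ⟨h1, h2, h3⟩ := hU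
  refine ⟨h1.const_mul k, fun x hx => ?_, fun x hx => ?_⟩
  · exact ((h2 x hx).const_mul hk).congr (sub_nonneg.2 hx.2.le) fun t _ => by ring
  · exact ((h3 x hx).const_mul hk).congr (sub_nonneg.2 hx.1.le) fun t _ => by ring

theorem IsLaplaceMajor.sub_const {f U : ℝ → ℝ} {a b : ℝ} (hU : IsLaplaceMajor f a b U) (k : ℝ) :
    IsLaplaceMajor f a b (fun x => U x - k) := by
  rw [isLaplaceMajor_iff] at hU ⊢
  obtain ⟨h1, h2, h3⟩ := hU
  exact ⟨h1.sub continuousOn_const, by simpa only [sub_sub_sub_cancel_right] using h2,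
    by simpa only [sub_sub_sub_cancel_right] using h3⟩

theorem IsLaplaceMajor.mono {f U : ℝ → ℝ} {a b c d : ℝ} (hU : IsLaplaceMajor f a b U)
    (hac : a ≤ c) (hdb : d ≤ b) : IsLaplaceMajor f c d U := by
  rw [isLaplaceMajor_iff] at hU ⊢
  obtain ⟨h1, h2, h3⟩ := hU
  refine ⟨h1.mono (Icc_subset_Icc hac hdb), fun x hx => ?_, fun x hx => ?_⟩
  · exact (laplaceGE_iff_of_le (sub_pos.2 hx.2) (by linarith)
      (h1.right_increment (hac.trans hx.1))).1 (h2 x ⟨hac.trans hx.1, hx.2.trans_le hdb⟩)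
  · exact (laplaceGE_iff_of_le (sub_pos.2 hx.1) (by linarith)
      (h1.left_increment (hx.2.trans hdb))).1 (h3 x ⟨hac.trans_lt hx.1, hx.2.trans hdb⟩)

theorem IsLaplaceMajor.of_eventually {f U : ℝ → ℝ} {a b : ℝ} (hU : ContinuousOn U (Icc a b))
    (hr : ∀ x ∈ Ico a b, ∀ ε > 0, ∃ η > 0, ∀ t ∈ Icc 0 η, t ≤ b - x →
      (f x - ε) * t ≤ U (x + t) - U x)
    (hl : ∀ x ∈ Ioc a b, ∀ ε > 0, ∃ η > 0, ∀ t ∈ Icc 0 η, t ≤ x - a →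
      (f x - ε) * t ≤ U x - U (x - t)) : IsLaplaceMajor f a b U :=
  isLaplaceMajor_iff.2 ⟨hU,
    fun x hx => .of_eventually (sub_pos.2 hx.2) (hU.right_increment hx.1) (hr x hx),
    fun x hx => .of_eventually (sub_pos.2 hx.1) (hU.left_increment hx.2) (hl x hx)⟩

theorem isLaplaceMajor_const_mul_id (k a b : ℝ) :
    IsLaplaceMajor (fun _ => k) a b (fun x => k * x) := by
  refine .of_eventually (by fun_prop) (fun x _ ε hε => ⟨1, one_pos, fun t ht _ => ?_⟩)
    (fun x _ ε hε => ⟨1, one_pos, fun t ht _ => ?_⟩) <;> nlinarith [ht.1]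

/-! ### Monotonicity theorem and comparison of increments -/

/-- Take the last point `x` with `W x ≥ W a`. If `x < b`, the positive right derivate yields a later
point where `W` exceeds `W x`, a contradiction. -/
theorem IsLaplaceMajor.le_of_pos {W : ℝ → ℝ} {a b ε : ℝ} (hab : a ≤ b) (hε : 0 < ε)
    (hW : IsLaplaceMajor (fun _ => ε) a b W) : W a ≤ W b := by
  obtain ⟨h1, h2, -⟩ := isLaplaceMajor_iff.1 hW
  have hcl : IsClosed (Icc a b ∩ W ⁻¹' Ici (W a)) :=
    h1.preimage_isClosed_of_isClosed isClosed_Icc isClosed_Ici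
  obtain ⟨x, ⟨hx, hWx⟩, hmax⟩ :=
    (isCompact_Icc.of_isClosed_subset hcl inter_subset_left).exists_isGreatest
      ⟨a, ⟨le_rfl, hab⟩, le_refl (W a)⟩
  rcases hx.2.eq_or_lt with rfl | hxb
  · exact hWx
  · obtain ⟨t, ht, hpos⟩ := (h2 x ⟨hx.1, hxb⟩).exists_pos (sub_nonneg.2 hx.2)
      (h1.right_increment hx.1) (by simp) hε
    have hle := hmax ⟨⟨by linarith [hx.1, ht.1], by linarith [ht.2]⟩,
      show W a ≤ W (x + t) from le_trans hWx (by linarith)⟩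
    linarith [ht.1]

/-- A continuous function with nonnegative lower Laplace derivates is nondecreasing. -/
theorem IsLaplaceMajor.le_of_zero {W : ℝ → ℝ} {a b : ℝ} (hab : a ≤ b)
    (hW : IsLaplaceMajor (fun _ => 0) a b W) : W a ≤ W b := by
  -- Adding `ε x` to `W` makes the derivates positive; afterwards `ε → 0`.
  have key : ∀ ε > 0, W a - W b ≤ ε * (b - a) := fun ε hε => by
    have := IsLaplaceMajor.le_of_pos hab hε
      (by simpa only [zero_add] using hW.add (isLaplaceMajor_const_mul_id ε a b))
    linarith
  have h : Tendsto (fun ε : ℝ => ε * (b - a)) (𝓝[>] 0) (𝓝 0) := by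
    have : Tendsto (fun ε : ℝ => ε * (b - a)) (𝓝 0) (𝓝 (0 * (b - a))) :=
      (by fun_prop : Continuous fun ε : ℝ => ε * (b - a)).tendsto 0
    rw [zero_mul] at this
    exact this.mono_left nhdsWithin_le_nhds
  have := ge_of_tendsto h (eventually_nhdsWithin_of_forall key)
  linarith

/-- The difference `U - V` has nonnegative lower derivates, hence is nondecreasing. -/
theorem IsLaplaceMajor.increment_ge {f U V : ℝ → ℝ} {a b : ℝ} (hab : a ≤ b)
    (hU : IsLaplaceMajor f a b U) (hV : IsLaplaceMinor f a b V) : V b - V a ≤ U b - U a := by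
  have h := hU.add (isLaplaceMinor_iff_neg.1 hV)
  simp only [add_neg_cancel] at h
  have := h.le_of_zero hab
  linarith

theorem IsLaplaceMinor.mono {f V : ℝ → ℝ} {a b c d : ℝ} (hV : IsLaplaceMinor f a b V)
    (hac : a ≤ c) (hdb : d ≤ b) : IsLaplaceMinor f c d V :=
  isLaplaceMinor_iff_neg.2 ((isLaplaceMinor_iff_neg.1 hV).mono hac hdb)

theorem IsLaplaceMinor.sub_const {f V : ℝ → ℝ} {a b : ℝ} (hV : IsLaplaceMinor f a b V) (k : ℝ) :
    IsLaplaceMinor f a b (fun x => V x - k) := by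
  rw [isLaplaceMinor_iff_neg] at hV ⊢
  simpa only [neg_sub, sub_neg_eq_add, neg_add_eq_sub] using hV.sub_const (-k)

/-- Major increments dominate minor ones, so increments of each kind within `ε` of `I` pin both the
infimum and the supremum. -/
theorem HasLaplaceIntegral.of_approx {f : ℝ → ℝ} {a b I : ℝ} (hab : a ≤ b)
    (hU : ∀ ε > 0, ∃ U, IsLaplaceMajor f a b U ∧ U b - U a ≤ I + ε)
    (hV : ∀ ε > 0, ∃ V, IsLaplaceMinor f a b V ∧ I - ε ≤ V b - V a) :
    HasLaplaceIntegral f a b I := by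
  refine ⟨⟨?_, fun r hr => ?_⟩, ⟨?_, fun r hr => ?_⟩⟩
  · rintro r ⟨U, hU', rfl⟩
    refine le_of_forall_pos_le_add fun ε hε => ?_
    obtain ⟨V, hV1, hV2⟩ := hV ε hε
    linarith [hU'.increment_ge hab hV1]
  · refine le_of_forall_pos_le_add fun ε hε => ?_
    obtain ⟨U, hU1, hU2⟩ := hU ε hε
    exact (hr ⟨U, hU1, rfl⟩).trans hU2
  · rintro r ⟨V, hV', rfl⟩
    refine le_of_forall_pos_le_add fun ε hε => ?_
    obtain ⟨U, hU1, hU2⟩ := hU ε hε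
    linarith [hU1.increment_ge hab hV']
  · refine le_of_forall_pos_le_add fun ε hε => ?_
    obtain ⟨V, hV1, hV2⟩ := hV ε hε
    linarith [hr ⟨V, hV1, rfl⟩]

theorem HasLaplaceIntegral.neg {f : ℝ → ℝ} {a b I : ℝ} (hab : a ≤ b)
    (h : HasLaplaceIntegral f a b I) : HasLaplaceIntegral (fun x => -f x) a b (-I) := by
  refine .of_approx hab (fun ε hε => ?_) (fun ε hε => ?_)
  · obtain ⟨r, ⟨V, hV, rfl⟩, hr, -⟩ := h.2.exists_between (sub_lt_self I hε)
    exact ⟨_, isLaplaceMinor_iff_neg.1 hV, by linarith⟩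
  · obtain ⟨r, ⟨U, hU, rfl⟩, -, hr⟩ := h.1.exists_between (lt_add_of_pos_right I hε)
    exact ⟨fun x => -U x, isLaplaceMinor_iff_neg.2 (by simpa only [neg_neg] using hU),
      by linarith⟩

/-! ### Lebesgue integrable functions are Laplace integrable -/

theorem MeasureTheory.IntegrableOn.intervalIntegrable_of_mem {h : ℝ → ℝ} {a b p q : ℝ}
    (hh : IntegrableOn h (Icc a b)) (hp : p ∈ Icc a b) (hq : q ∈ Icc a b) :
    IntervalIntegrable h volume p q :=
  (hh.mono_set (uIcc_subset_Icc hp hq)).intervalIntegrable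

/-- A Lebesgue integrable function has major functions whose increments are close to its
integral. -/
theorem exists_isLaplaceMajor_of_integrableOn {h : ℝ → ℝ} {a b ε : ℝ} (hab : a ≤ b)
    (hh : IntegrableOn h (Icc a b)) (hε : 0 < ε) :
    ∃ U, IsLaplaceMajor h a b U ∧ U b - U a ≤ (∫ x in a..b, h x) + ε := by
  -- Vitali–Carathéodory: a lower semicontinuous `u > h` with nearly the same integral. Its
  -- primitive is the major function.
  obtain ⟨u, hlt, hlsc, hint, htop, hu⟩ := exists_lt_lowerSemicontinuous_integral_lt h hh hε
  have hu' : IntegrableOn (fun x => (u x).toReal) (Icc a b) := hint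
  have hsub : ∀ p ∈ Icc a b, ∀ q ∈ Icc a b,
      (∫ y in a..q, (u y).toReal) - ∫ y in a..p, (u y).toReal = ∫ y in p..q, (u y).toReal :=
    fun p hp q hq => intervalIntegral.integral_interval_sub_left
      (hu'.intervalIntegrable_of_mem ⟨le_rfl, hab⟩ hq)
      (hu'.intervalIntegrable_of_mem ⟨le_rfl, hab⟩ hp)
  -- Since `u x > h x`, lower semicontinuity gives `u > h x` near `x`, which bounds the lower Dini
  -- derivates of the primitive at `x` by `h x` from below.
  have hloc : ∀ x, ∃ η > 0, ∀ p ∈ Icc a b, ∀ q ∈ Icc a b, x - η ≤ p → p ≤ q → q ≤ x + η →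
      h x * (q - p) ≤ ∫ y in p..q, (u y).toReal := by
    intro x
    obtain ⟨η, hη, hball⟩ := Metric.nhds_basis_closedBall.eventually_iff.1 (hlsc x (h x) (hlt x))
    refine ⟨η, hη, fun p hp q hq hxp hpq hxq => ?_⟩
    have := intervalIntegral.integral_mono_ae_restrict (μ := volume) hpq
      (f := fun _ => h x) (g := fun y => (u y).toReal) (by simp)
      (hu'.intervalIntegrable_of_mem hp hq) (by
        filter_upwards [ae_restrict_of_ae_restrict_of_subset (Icc_subset_Icc hp.1 hq.2) htop,
          ae_restrict_mem measurableSet_Icc] with y hy hyI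
        have h1 : (h x : EReal) < u y := hball (by
          rw [Real.closedBall_eq_Icc]
          exact ⟨hxp.trans hyI.1, hyI.2.trans hxq⟩)
        simpa using EReal.toReal_le_toReal h1.le (EReal.coe_ne_bot _) hy.ne)
    rw [intervalIntegral.integral_const, smul_eq_mul, mul_comm] at this
    exact this
  refine ⟨fun x => ∫ y in a..x, (u y).toReal, .of_eventually ?_ (fun x hx e he => ?_)
    (fun x hx e he => ?_), ?_⟩
  · rw [← uIcc_of_le hab]
    exact intervalIntegral.continuousOn_primitive_interval (by rwa [uIcc_of_le hab])
  · obtain ⟨η, hη, H⟩ := hloc x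
    refine ⟨η, hη, fun t ht htb => ?_⟩
    have hx' : x ∈ Icc a b := ⟨hx.1, hx.2.le⟩
    have hxt : x + t ∈ Icc a b := ⟨by linarith [hx.1, ht.1], by linarith⟩
    have := H x hx' (x + t) hxt (by linarith) (by linarith [ht.1]) (by linarith [ht.2])
    rw [hsub x hx' _ hxt]
    nlinarith [ht.1]
  · obtain ⟨η, hη, H⟩ := hloc x
    refine ⟨η, hη, fun t ht htb => ?_⟩
    have hx' : x ∈ Icc a b := ⟨hx.1.le, hx.2⟩
    have hxt : x - t ∈ Icc a b := ⟨by linarith, by linarith [hx.2, ht.1]⟩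
    have := H (x - t) hxt x hx' (by linarith [ht.2]) (by linarith [ht.1]) (by linarith)
    rw [hsub _ hxt x hx']
    nlinarith [ht.1]
  · simp only [intervalIntegral.integral_same, sub_zero]
    rw [intervalIntegral.integral_of_le hab, intervalIntegral.integral_of_le hab,
      ← integral_Icc_eq_integral_Ioc, ← integral_Icc_eq_integral_Ioc]
    exact hu.le

/-- A Lebesgue integrable function is Laplace integrable, with the same integral. -/
theorem MeasureTheory.IntegrableOn.hasLaplaceIntegral {h : ℝ → ℝ} {a b : ℝ} (hab : a ≤ b)
    (hh : IntegrableOn h (Icc a b)) : HasLaplaceIntegral h a b (∫ x in a..b, h x) := by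
  refine .of_approx hab (fun ε hε => exists_isLaplaceMajor_of_integrableOn hab hh hε)
    (fun ε hε => ?_)
  obtain ⟨U, hU, hU'⟩ := exists_isLaplaceMajor_of_integrableOn (h := fun x => -h x) hab hh.neg hε
  rw [intervalIntegral.integral_neg] at hU'
  exact ⟨fun x => -U x, isLaplaceMinor_iff_neg.2 (by simpa only [neg_neg] using hU), by linarith⟩

/-! ### Multiplying a major function by a primitive -/

/-- The quantity inside the absolute value is the integral of `(U r - U y) g y` over `[p, q]`. -/
theorem MeasureTheory.IntegrableOn.abs_mul_sub_integral_le {U g G : ℝ → ℝ} {a b p q M e r : ℝ}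
    (hU : Continuous U) (hg : IntegrableOn g (Icc a b)) (hM : ∀ x ∈ Icc a b, |g x| ≤ M)
    (hp : p ∈ Icc a b) (hq : q ∈ Icc a b) (hpq : p ≤ q) (hG : G q - G p = ∫ y in p..q, g y)
    (he : ∀ y ∈ Icc p q, |U r - U y| ≤ e) :
    |U r * (G q - G p) - ∫ y in p..q, U y * g y| ≤ e * M * (q - p) := by
  have hgi := hg.intervalIntegrable_of_mem hp hq
  rw [hG, ← intervalIntegral.integral_const_mul, ← intervalIntegral.integral_sub
    (hgi.const_mul _) (hgi.continuousOn_mul hU.continuousOn), ← abs_of_nonneg (sub_nonneg.2 hpq)]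
  refine intervalIntegral.norm_integral_le_of_norm_le_const (E := ℝ) fun y hy => ?_
  rw [uIoc_of_le hpq] at hy
  rw [← sub_mul, norm_mul]
  have h1 := he y ⟨hy.1.le, hy.2⟩
  exact mul_le_mul h1 (hM y ⟨hp.1.trans hy.1.le, hy.2.trans hq.2⟩) (abs_nonneg _)
    ((abs_nonneg _).trans h1)

/-- If `U` is a major function of `f` and `G ≥ 0` is a primitive of a bounded `g`, then
`U G - ∫ U g` is a major function of `f G`. -/
theorem IsLaplaceMajor.mul_primitive {f U g G : ℝ → ℝ} {a b M : ℝ} (hU : IsLaplaceMajor f a b U)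
    (hUc : Continuous U) (hab : a ≤ b) (hg : IntegrableOn g (Icc a b))
    (hM : ∀ x ∈ Icc a b, |g x| ≤ M)
    (hG : ∀ p ∈ Icc a b, ∀ q ∈ Icc a b, G q - G p = ∫ y in p..q, g y)
    (hG0 : ∀ x ∈ Icc a b, 0 ≤ G x) :
    IsLaplaceMajor (fun x => G x * f x) a b (fun x => U x * G x - ∫ y in a..x, U y * g y) := by
  have ha : a ∈ Icc a b := ⟨le_rfl, hab⟩
  have hM0 : 0 ≤ M := (abs_nonneg _).trans (hM a ha)
  have hUg : IntegrableOn (fun y => U y * g y) (Icc a b) :=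
    hg.continuousOn_mul hUc.continuousOn isCompact_Icc
  have hGc : ContinuousOn G (Icc a b) := by
    have h : ContinuousOn (fun x => G a + ∫ y in a..x, g y) (Icc a b) := by
      rw [← uIcc_of_le hab]
      exact continuousOn_const.add
        (intervalIntegral.continuousOn_primitive_interval (by rwa [uIcc_of_le hab]))
    exact h.congr fun x hx => by simp only [← hG a ha x hx]; ring
  have hWc : ContinuousOn (fun x => U x * G x - ∫ y in a..x, U y * g y) (Icc a b) := by
    refine (hUc.continuousOn.mul hGc).sub ?_
    rw [← uIcc_of_le hab]
    exact intervalIntegral.continuousOn_primitive_interval (by rwa [uIcc_of_le hab])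
  have hsub : ∀ p ∈ Icc a b, ∀ q ∈ Icc a b,
      (∫ y in a..q, U y * g y) - ∫ y in a..p, U y * g y = ∫ y in p..q, U y * g y :=
    fun p hp q hq => intervalIntegral.integral_interval_sub_left
      (hUg.intervalIntegrable_of_mem ha hq) (hUg.intervalIntegrable_of_mem ha hp)
  -- The remainder in the product rule is `o(q - p)`. It is used with `[p, q]` equal to `[x, x + t]`
  -- or `[x - t, x]`, and with `r` the end point other than `x`.
  have hloc : ∀ x, ∀ ε > 0, ∃ η > 0, ∀ p ∈ Icc a b, ∀ q ∈ Icc a b, ∀ r ∈ Icc p q,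
      x - η ≤ p → p ≤ q → q ≤ x + η →
      -ε * (q - p) ≤ U r * (G q - G p) - ∫ y in p..q, U y * g y := by
    intro x ε hε
    -- The factor `2` appears because `U r` and `U y` are compared through `U x`; `M + 1` avoids a
    -- zero denominator.
    have hε' : 0 < ε / (2 * (M + 1)) := by positivity
    obtain ⟨η, hη, H⟩ := Metric.nhds_basis_closedBall.eventually_iff.1
      (Metric.tendsto_nhds.1 (hUc.tendsto x) _ hε')
    refine ⟨η, hη, fun p hp q hq r hr hxp hpq hxq => ?_⟩
    have hy : ∀ y ∈ Icc p q, |U y - U x| < ε / (2 * (M + 1)) := fun y hy => H (by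
      rw [Real.closedBall_eq_Icc]
      exact ⟨hxp.trans hy.1, hy.2.trans hxq⟩)
    have h1 := hg.abs_mul_sub_integral_le hUc hM hp hq hpq (hG p hp q hq) (r := r)
      (e := ε / (M + 1)) (fun y hyI => by
        have h2 := abs_lt.1 (hy y hyI)
        have h3 := abs_lt.1 (hy r hr)
        have h4 : ε / (M + 1) = ε / (2 * (M + 1)) + ε / (2 * (M + 1)) := by
          field_simp
          ring
        rw [abs_le]
        constructor <;> linarith)
    have h5 : ε / (M + 1) * M ≤ ε := by
      rw [div_mul_eq_mul_div, div_le_iff₀ (by positivity)]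
      nlinarith
    have h6 := mul_le_mul_of_nonneg_right h5 (sub_nonneg.2 hpq)
    linarith [(abs_le.1 h1).1]
  obtain ⟨-, h2, h3⟩ := isLaplaceMajor_iff.1 hU
  refine isLaplaceMajor_iff.2 ⟨hWc, fun x hx => ?_, fun x hx => ?_⟩
  · have hx' : x ∈ Icc a b := ⟨hx.1, hx.2.le⟩
    have hd := sub_nonneg.2 hx'.2
    have hR := hWc.right_increment hx.1
    have hS := ((hUc.continuousOn (s := Icc a b)).right_increment hx.1).const_mul (G x)
    -- The increment splits as `G x` times the increment of `U`, plus this remainder of lower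
    -- derivate at least `0`.
    have hrem := LaplaceGE.of_eventually (m := 0) (sub_pos.2 hx.2) (hR.sub hS) (fun ε hε => by
      obtain ⟨η, hη, H⟩ := hloc x ε hε
      refine ⟨η, hη, fun t ht htb => ?_⟩
      have hxt : x + t ∈ Icc a b := ⟨by linarith [hx.1, ht.1], by linarith⟩
      have h := H x hx' _ hxt (x + t) ⟨by linarith [ht.1], le_rfl⟩ (by linarith)
        (by linarith [ht.1]) (by linarith [ht.2])
      rw [← hsub x hx' _ hxt] at h
      simp only [Pi.sub_apply]
      linarith)
    have h := ((h2 x hx).const_mul (hG0 x hx')).add hd hS (hR.sub hS) hrem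
    rw [add_zero] at h
    exact h.congr hd fun t _ => by simp only [Pi.sub_apply]; ring
  · have hx' : x ∈ Icc a b := ⟨hx.1.le, hx.2⟩
    have hd := sub_nonneg.2 hx'.1
    have hR := hWc.left_increment hx.2
    have hS := ((hUc.continuousOn (s := Icc a b)).left_increment hx.2).const_mul (G x)
    have hrem := LaplaceGE.of_eventually (m := 0) (sub_pos.2 hx.1) (hR.sub hS) (fun ε hε => by
      obtain ⟨η, hη, H⟩ := hloc x ε hε
      refine ⟨η, hη, fun t ht htb => ?_⟩
      have hxt : x - t ∈ Icc a b := ⟨by linarith, by linarith [hx.2, ht.1]⟩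
      have h := H _ hxt x hx' (x - t) ⟨le_rfl, by linarith [ht.1]⟩ (by linarith [ht.2])
        (by linarith [ht.1]) (by linarith)
      rw [← hsub _ hxt x hx'] at h
      simp only [Pi.sub_apply]
      linarith)
    have h := ((h3 x hx).const_mul (hG0 x hx')).add hd hS (hR.sub hS) hrem
    rw [add_zero] at h
    exact h.congr hd fun t _ => by simp only [Pi.sub_apply]; ring

/-! ### Integration by parts on a compact interval -/

/-- Extending `U` by constants outside `[a, b]` supplies the global continuity assumed in
`IsLaplaceMajor.mul_primitive`. -/
theorem IsLaplaceMajor.exists_continuous {f U : ℝ → ℝ} {a b : ℝ} (hab : a ≤ b)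
    (hU : IsLaplaceMajor f a b U) :
    ∃ W, Continuous W ∧ IsLaplaceMajor f a b W ∧ EqOn U W (Icc a b) := by
  have h : EqOn U (IccExtend hab ((Icc a b).domRestrict U)) (Icc a b) := fun x hx => by
    rw [IccExtend_of_mem hab _ hx, domRestrict_apply]
  exact ⟨_, hU.continuousOn.domRestrict.Icc_extend', hU.congr h, h⟩

/-- Normalized major and minor functions close to the primitive of a Laplace integrable
function. -/
theorem exists_isLaplaceMajor_isLaplaceMinor {f F : ℝ → ℝ} {a b ε : ℝ} (hab : a ≤ b)
    (hF : ∀ x ∈ Icc a b, HasLaplaceIntegral f a x (F x)) (hε : 0 < ε) :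
    ∃ U V, Continuous U ∧ IsLaplaceMajor f a b U ∧ IsLaplaceMinor f a b V ∧ U a = 0 ∧ V a = 0 ∧
      ∀ x ∈ Icc a b, V x ≤ F x ∧ F x ≤ U x ∧ U x ≤ V x + ε := by
  have hFb := hF b ⟨hab, le_rfl⟩
  obtain ⟨_, ⟨U₀, hU₀, rfl⟩, -, hU₁⟩ := hFb.1.exists_between (lt_add_of_pos_right _ (half_pos hε))
  obtain ⟨_, ⟨V₀, hV₀, rfl⟩, hV₁, -⟩ := hFb.2.exists_between (sub_lt_self _ (half_pos hε))
  obtain ⟨U, hUc, hU, hUe⟩ := (hU₀.sub_const (U₀ a)).exists_continuous hab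
  have hUa : U a = 0 := by simp [← hUe ⟨le_rfl, hab⟩]
  have hUb : U b = U₀ b - U₀ a := (hUe ⟨hab, le_rfl⟩).symm
  have hV := hV₀.sub_const (V₀ a)
  refine ⟨U, fun x => V₀ x - V₀ a, hUc, hU, hV, hUa, sub_self _, fun x hx => ⟨?_, ?_, ?_⟩⟩
  · exact (hF x hx).2.1 ⟨V₀, hV₀.mono le_rfl hx.2, rfl⟩
  · exact (hF x hx).1.1 ⟨U, hU.mono le_rfl hx.2, by rw [hUa, sub_zero]⟩
  -- `U - V` is nondecreasing on `[x, b]`, so its value at `x` is at most its value at `b`.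
  · have := (hU.mono hx.1 le_rfl).increment_ge hx.2 (hV.mono hx.1 le_rfl)
    linarith

/-- `F` is a uniform limit of continuous major functions. -/
theorem HasLaplaceIntegral.continuousOn_primitive {f F : ℝ → ℝ} {a b : ℝ} (hab : a ≤ b)
    (hF : ∀ x ∈ Icc a b, HasLaplaceIntegral f a x (F x)) : ContinuousOn F (Icc a b) := by
  refine continuousOn_of_uniform_approx_of_continuousOn fun u hu => ?_
  obtain ⟨ε, hε, H⟩ := Metric.mem_uniformity_dist.1 hu
  obtain ⟨U, V, hUc, -, -, -, -, h⟩ := exists_isLaplaceMajor_isLaplaceMinor hab hF (half_pos hε)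
  refine ⟨U, hUc.continuousOn, fun x hx => H ?_⟩
  obtain ⟨h1, h2, h3⟩ := h x hx
  rw [Real.dist_eq, abs_lt]
  constructor <;> linarith

/-- With `G = ∫ g` and `K ≥ |G|`, the function `W` is the product construction for `U` and `G + K ≥
0`, minus `K V`. -/
theorem exists_isLaplaceMajor_mul {f F g : ℝ → ℝ} {a b M ε : ℝ} (hab : a ≤ b)
    (hF : ∀ x ∈ Icc a b, HasLaplaceIntegral f a x (F x)) (hg : IntegrableOn g (Icc a b))
    (hM : ∀ x ∈ Icc a b, |g x| ≤ M) (hε : 0 < ε) :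
    ∃ W, IsLaplaceMajor (fun x => f x * ∫ y in a..x, g y) a b W ∧
      W b - W a ≤ (F b * (∫ y in a..b, g y) - ∫ y in a..b, F y * g y) + ε := by
  have ha : a ∈ Icc a b := ⟨le_rfl, hab⟩
  have hb : b ∈ Icc a b := ⟨hab, le_rfl⟩
  have hM0 : 0 ≤ M := (abs_nonneg _).trans (hM a ha)
  have hFc := HasLaplaceIntegral.continuousOn_primitive hab hF
  set K := M * (b - a) with hK
  have hK0 : 0 ≤ K := mul_nonneg hM0 (sub_nonneg.2 hab)
  have hGK : ∀ x ∈ Icc a b, |∫ y in a..x, g y| ≤ K := fun x hx => by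
    have h := intervalIntegral.norm_integral_le_of_norm_le_const (f := g) (a := a) (b := x)
      (C := M) fun y hy => by
        rw [uIoc_of_le hx.1] at hy
        exact hM y ⟨hy.1.le, hy.2.trans hx.2⟩
    rw [abs_of_nonneg (sub_nonneg.2 hx.1)] at h
    exact h.trans (mul_le_mul_of_nonneg_left (by linarith [hx.2]) hM0)
  -- Error budget for an `e`-approximation: at most `2 e K` from `U b (G b + K)`, `e K` from `K V b`
  -- and `e K` from `∫ U g`. The `+ 1` covers `K = 0`.
  have he : 0 < ε / (4 * K + 1) := by positivity
  obtain ⟨U, V, hUc, hU, hV, hUa, hVa, h⟩ := exists_isLaplaceMajor_isLaplaceMinor hab hF he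
  set e := ε / (4 * K + 1) with he_def
  have h1 := hU.mul_primitive (G := fun x => (∫ y in a..x, g y) + K) hUc hab hg hM
    (fun p hp q hq => by
      rw [← intervalIntegral.integral_interval_sub_left
        (hg.intervalIntegrable_of_mem ha hq) (hg.intervalIntegrable_of_mem ha hp)]
      ring)
    (fun x hx => by linarith [(abs_le.1 (hGK x hx)).1])
  have h2 := h1.add ((isLaplaceMinor_iff_neg.1 hV).const_mul hK0)
  refine ⟨_, by convert h2 using 2; ring, ?_⟩
  simp only [hUa, hVa, intervalIntegral.integral_same]
  have hgi := hg.intervalIntegrable_of_mem ha hb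
  have h3 : (∫ y in a..b, F y * g y) - (∫ y in a..b, U y * g y) ≤ e * K := by
    rw [← intervalIntegral.integral_sub (hgi.continuousOn_mul (by rwa [uIcc_of_le hab]))
      (hgi.continuousOn_mul hUc.continuousOn)]
    have h := intervalIntegral.norm_integral_le_of_norm_le_const (a := a) (b := b)
      (f := fun y => F y * g y - U y * g y) (C := e * M) fun y hy => by
        rw [uIoc_of_le hab] at hy
        have hy' : y ∈ Icc a b := ⟨hy.1.le, hy.2⟩
        obtain ⟨k1, k2, k3⟩ := h y hy'
        rw [← sub_mul, norm_mul]
        refine mul_le_mul ?_ (hM y hy') (abs_nonneg _) he.le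
        rw [Real.norm_eq_abs, abs_le]
        constructor <;> linarith
    rw [abs_of_nonneg (sub_nonneg.2 hab), mul_assoc] at h
    exact (le_abs_self _).trans h
  obtain ⟨k1, k2, k3⟩ := h b hb
  have hGb := abs_le.1 (hGK b hb)
  have h4 : U b * ((∫ y in a..b, g y) + K) ≤ (F b + e) * ((∫ y in a..b, g y) + K) :=
    mul_le_mul_of_nonneg_right (by linarith) (by linarith)
  have h5 : K * (F b - e) ≤ K * V b := mul_le_mul_of_nonneg_left (by linarith) hK0
  have h6 : e * (∫ y in a..b, g y) ≤ e * K := mul_le_mul_of_nonneg_left hGb.2 he.le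
  have h7 : e * (4 * K + 1) = ε := div_mul_cancel₀ _ (by positivity)
  linarith

/-- Integration by parts for the Laplace integral on a compact interval. -/
theorem HasLaplaceIntegral.mul_primitive {f F g : ℝ → ℝ} {a b M : ℝ} (hab : a ≤ b)
    (hF : ∀ x ∈ Icc a b, HasLaplaceIntegral f a x (F x)) (hg : IntegrableOn g (Icc a b))
    (hM : ∀ x ∈ Icc a b, |g x| ≤ M) :
    HasLaplaceIntegral (fun x => f x * ∫ y in a..x, g y) a b
      (F b * (∫ y in a..b, g y) - ∫ y in a..b, F y * g y) := by
  refine .of_approx hab (fun ε hε => exists_isLaplaceMajor_mul hab hF hg hM hε) (fun ε hε => ?_)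
  obtain ⟨W, hW, hW'⟩ := exists_isLaplaceMajor_mul (f := fun x => -f x) (F := fun x => -F x) hab
    (fun x hx => (hF x hx).neg hx.1) hg hM hε
  simp only [neg_mul, intervalIntegral.integral_neg] at hW hW'
  exact ⟨fun x => -W x, isLaplaceMinor_iff_neg.2 (by simpa only [neg_neg] using hW), by linarith⟩

/-! ### Passage to the unbounded interval -/

theorem HasLaplaceIntegral.congr {f h : ℝ → ℝ} {a b I : ℝ} (hf : HasLaplaceIntegral f a b I)
    (hfh : EqOn f h (Icc a b)) : HasLaplaceIntegral h a b I := by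
  have hU : ∀ U, IsLaplaceMajor f a b U ↔ IsLaplaceMajor h a b U := fun U => by
    rw [isLaplaceMajor_iff, isLaplaceMajor_iff]
    exact and_congr_right' (and_congr
      (forall₂_congr fun x hx => by rw [hfh ⟨hx.1, hx.2.le⟩])
      (forall₂_congr fun x hx => by rw [hfh ⟨hx.1.le, hx.2⟩]))
  have hV : ∀ V, IsLaplaceMinor f a b V ↔ IsLaplaceMinor h a b V := fun V =>
    ⟨fun ⟨h1, h2, h3⟩ => ⟨h1, fun x hx => hfh ⟨hx.1, hx.2.le⟩ ▸ h2 x hx,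
      fun x hx => hfh ⟨hx.1.le, hx.2⟩ ▸ h3 x hx⟩,
    fun ⟨h1, h2, h3⟩ => ⟨h1, fun x hx => hfh ⟨hx.1, hx.2.le⟩ ▸ h2 x hx,
      fun x hx => hfh ⟨hx.1.le, hx.2⟩ ▸ h3 x hx⟩⟩
  simpa only [HasLaplaceIntegral, laplaceMajorIncrements, laplaceMinorIncrements, hU, hV] using hf

theorem LaplaceIntegrable.hasLaplaceIntegral {f : ℝ → ℝ} {a b : ℝ}
    (h : LaplaceIntegrable f a b) : HasLaplaceIntegral f a b (laplaceIntegral f a b) := by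
  obtain ⟨I, hI⟩ := h
  rwa [hI.laplaceIntegral_eq]

theorem LaplaceIntegrableIci.of_tendsto {h I : ℝ → ℝ} {a L : ℝ}
    (hI : ∀ c, a ≤ c → HasLaplaceIntegral h a c (I c)) (hL : Tendsto I atTop (𝓝 L)) :
    LaplaceIntegrableIci h a ∧ laplaceIntegralIci h a = L := by
  have ht : Tendsto (fun c => laplaceIntegral h a c) atTop (𝓝 L) := by
    refine hL.congr' ?_
    filter_upwards [eventually_ge_atTop a] with c hc
    exact (hI c hc).laplaceIntegral_eq.symm
  exact ⟨⟨fun c hc => ⟨_, hI c hc⟩, L, ht⟩, ht.limUnder_eq⟩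

/-- Integration by parts on `[a, ∞)` for a bounded primitive `F`. -/
theorem laplaceIntegrableIci_mul_primitive {a L M : ℝ} {f g F G : ℝ → ℝ}
    (hf : ∀ c, a ≤ c → LaplaceIntegrable f a c)
    (hF : ∀ x, a ≤ x → F x = laplaceIntegral f a x) (hFM : ∀ x, a ≤ x → |F x| ≤ M)
    (hg : IntegrableOn g (Ici a)) (hgb : BoundedVariationOn g (Ici a))
    (hG : ∀ x, a ≤ x → G x = laplaceIntegral g a x)
    (hL : Tendsto (fun x => F x * G x) atTop (𝓝 L)) :
    LaplaceIntegrableIci (fun x => f x * G x) a ∧ LaplaceIntegrableIci (fun x => F x * g x) a ∧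
      laplaceIntegralIci (fun x => f x * G x) a
        = L - laplaceIntegralIci (fun x => F x * g x) a := by
  have hF' : ∀ x, a ≤ x → HasLaplaceIntegral f a x (F x) := fun x hx => by
    rw [hF x hx]
    exact (hf x hx).hasLaplaceIntegral
  have hgc : ∀ c, IntegrableOn g (Icc a c) := fun c => hg.mono_set Icc_subset_Ici_self
  have hG' : ∀ x, a ≤ x → G x = ∫ y in a..x, g y := fun x hx => by
    rw [hG x hx, ((hgc x).hasLaplaceIntegral hx).laplaceIntegral_eq]
  -- Bounded variation makes `g` bounded, as the compact formula requires.
  have hgM : ∀ x ∈ Ici a, |g x| ≤ |g a| + (eVariationOn g (Ici a)).toReal := fun x hx => by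
    have h := hgb.dist_le hx self_mem_Ici
    rw [Real.dist_eq] at h
    linarith [abs_sub_abs_le_abs_sub (g x) (g a)]
  have hFc : ContinuousOn F (Ici a) := by
    intro x hx
    have h := HasLaplaceIntegral.continuousOn_primitive (show a ≤ x + 1 by linarith [mem_Ici.1 hx])
      (fun y hy => hF' y hy.1) x ⟨hx, by linarith⟩
    refine h.mono_of_mem_nhdsWithin ?_
    rw [← Ici_inter_Iic]
    exact inter_mem self_mem_nhdsWithin (mem_nhdsWithin_of_mem_nhds (Iic_mem_nhds (by linarith)))
  -- A bounded continuous `F` times an `L¹` function: the Laplace integrals of `F g` are Lebesgue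
  -- integrals and converge.
  have hFg : IntegrableOn (fun x => F x * g x) (Ici a) := by
    refine Integrable.bdd_mul (c := M) hg (hFc.aestronglyMeasurable measurableSet_Ici) ?_
    filter_upwards [ae_restrict_mem measurableSet_Ici] with x hx
    exact hFM x hx
  have hlim := intervalIntegral_tendsto_integral_Ioi a (hFg.mono_set Ioi_subset_Ici_self)
    tendsto_id
  obtain ⟨h1, h1'⟩ := LaplaceIntegrableIci.of_tendsto
    (fun c hc => (hFg.mono_set Icc_subset_Ici_self).hasLaplaceIntegral hc) hlim
  obtain ⟨h2, h2'⟩ := LaplaceIntegrableIci.of_tendsto (h := fun x => f x * G x) (fun c hc => by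
    have h := (HasLaplaceIntegral.mul_primitive hc (fun x hx => hF' x hx.1) (hgc c)
      fun x hx => hgM x hx.1).congr (h := fun x => f x * G x)
      fun x hx => by simp only [hG' x hx.1]
    rw [← hG' c hc] at h
    exact h) (hL.sub hlim)
  exact ⟨h2, h1, by rw [h1', h2']⟩

theorem mainTheorem12 :
    (∀ (a : ℝ) (f g F G : ℝ → ℝ),
      (∀ c, a ≤ c → LaplaceIntegrable f a c) →
      (∀ x, a ≤ x → F x = laplaceIntegral f a x) →
      (∃ M : ℝ, ∀ x, a ≤ x → |F x| ≤ M) →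
      IntegrableOn g (Ici a) → BoundedVariationOn g (Ici a) →
      (∀ x, a ≤ x → G x = laplaceIntegral g a x) →
      (∃ L : ℝ, Tendsto (fun x => F x * G x) atTop (𝓝 L)) →
      LaplaceIntegrableIci (fun x => f x * G x) a) ∧
    (∀ (a : ℝ) (f g F G : ℝ → ℝ),
      LaplaceIntegrableIci f a →
      (∀ x, a ≤ x → F x = laplaceIntegral f a x) →
      IntegrableOn g (Ici a) → BoundedVariationOn g (Ici a) →
      (∀ x, a ≤ x → G x = laplaceIntegral g a x) →
      LaplaceIntegrableIci (fun x => f x * G x) a ∧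
      LaplaceIntegrableIci (fun x => F x * g x) a ∧
      ∃ L : ℝ, Tendsto (fun x => F x * G x) atTop (𝓝 L) ∧
        laplaceIntegralIci (fun x => f x * G x) a
          = L - laplaceIntegralIci (fun x => F x * g x) a) := by
  refine ⟨fun a f g F G hf hF ⟨M, hM⟩ hg hgb hG ⟨L, hL⟩ =>
    (laplaceIntegrableIci_mul_primitive hf hF hM hg hgb hG hL).1,
    fun a f g F G hf hF hg hgb hG => ?_⟩
  obtain ⟨hf, A, hA⟩ := hf
  have hFA : Tendsto F atTop (𝓝 A) := by
    refine hA.congr' ?_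
    filter_upwards [eventually_ge_atTop a] with x hx using (hF x hx).symm
  have hGB : Tendsto G atTop (𝓝 (∫ x in Ioi a, g x)) := by
    refine (intervalIntegral_tendsto_integral_Ioi a (hg.mono_set Ioi_subset_Ici_self)
      tendsto_id).congr' ?_
    filter_upwards [eventually_ge_atTop a] with x hx
    rw [hG x hx, ((hg.mono_set Icc_subset_Ici_self).hasLaplaceIntegral hx).laplaceIntegral_eq, id]
  -- Convergence bounds `F` near `∞`, and continuity bounds it on the remaining compact interval.
  obtain ⟨M, hM⟩ : ∃ M : ℝ, ∀ x, a ≤ x → |F x| ≤ M := by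
    obtain ⟨c, hc⟩ := eventually_atTop.1 (hFA.abs.eventually_le_const (lt_add_one |A|))
    have hFc : ContinuousOn F (Icc a (max a c)) :=
      HasLaplaceIntegral.continuousOn_primitive (f := f) (le_max_left _ _) fun x hx => by
        rw [hF x hx.1]
        exact (hf x hx.1).hasLaplaceIntegral
    obtain ⟨C, hC⟩ := isCompact_Icc.exists_bound_of_continuousOn hFc
    refine ⟨max C (|A| + 1), fun x hx => ?_⟩
    rcases le_total x (max a c) with h | h
    · exact (hC x ⟨hx, h⟩).trans (le_max_left _ _)
    · exact (hc x ((le_max_right _ _).trans h)).trans (le_max_right _ _)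
  obtain ⟨h1, h2, h3⟩ := laplaceIntegrableIci_mul_primitive hf hF hM hg hgb hG (hFA.mul hGB)
  exact ⟨h1, h2, _, hFA.mul hGB, h3⟩
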